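/- Let $T\ge 1$ and let $J_T$ be an arbitrary period-$T$ Jacobi operator, i.e. the infinite real tridiagonal symmetric matrix with rows and columns indexed by $1,2,3,\dots$, diagonal entries $(b_n)_{n\ge1}$ and off-diagonal entries $(J_T)_{n,n+1}=(J_T)_{n+1,n}=a_n$, where $a_n>0$, $b_n\in\mathbb R$, $a_{n+T}=a_n$ and $b_{n+T}=b_n$ for all $n$; put $a_0:=a_T$. Let $$M(\lambda)=B_T(\lambda)\cdots B_1(\lambda),\qquad B_i(\lambda)=\begin{pmatrix}0&1\\ -\frac{a_{i-1}}{a_i}&\frac{\lambda-b_i}{a_i}\end{pmatrix},$$ let $\sigma_{ell}(J_T)=\{\lambda\in\mathbb R : |\operatorname{Tr}M(\lambda)|<2\}$, and for $\lambda\in\sigma_{ell}(J_T)$ let the quasi-momentum $\theta(\lambda)\in(0,\pi)$ be the number such that $M(\lambda)$ has the eigenvalues $e^{\pm i\theta(\lambda)}$. Let $n\ge 0$ and let $\lambda_1,\dots,\lambda_n\in\sigma_{ell}(J_T)$ be such that $\theta(\lambda_i)=\frac{p_i\pi}{q_i}\ne\frac{\pi}{2}$ for all $i\le n$, where $p_i,q_i\in\mathbb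 N$, $\gcd(p_i,q_i)=1$, and $\gcd(q_i,q_j)=1$ for all $i\ne j$. Let $(\lambda_i)_{i=n+1}^\infty$ be a sequence in $\sigma_{ell}(J_T)$ such that for every $k\ge1$ the numbers $\pi,\theta(\lambda_{n+1}),\dots,\theta(\lambda_{n+k})$ are rationally independent (linearly independent over $\mathbb Q$). Then for any positive sequence $(K(m))_{m\ge1}$ with $K(m)\to\infty$ as $m\to\infty$ (arbitrarily slowly) there is a single real potential $(q_m)_{m\ge1}$ with $$|q_m|\le\frac{K(m)}{m}\ \text{ for all } m\ge1,\qquad q_m\to0\ \text{ as } m\to\infty,\qquad q_m=0\ \text{ unless } m\equiv1 \pmod T,$$ such that, with $Q$ the infinite diagonal matrix with entries $(q_m)$, for every $i\ge1$ there is a non-zero vector $(u_{m,i})_{m\ge1}\in\ell^2(\mathbb N;\mathbb R)$ with $$(J_T+Q)(u_{m,i})_{m\ge1}=\lambda_i\,(u_{m,i})_{m\ge1}.$$ -/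

import Mathlib

open Filter Topology

/-- The coefficients of a period-`T` Jacobi operator: real sequences `a₁, a₂, …` (positive) and
`b₁, b₂, …`, both periodic with period `T ≥ 1`. The value `a 0` is the convention `a₀ := a_T`;
the value `b 0` is never used. -/
structure PeriodicJacobi (T : ℕ) where
  a : ℕ → ℝ
  b : ℕ → ℝ
  period_pos : 0 < T
  a_pos : ∀ n, 0 < a n
  a_periodic : ∀ n, a (n + T) = a n
  b_periodic : ∀ n, b (n + T) = b n

namespace PeriodicJacobi

variable {T : ℕ} (J : PeriodicJacobi T)

/-- The infinite tridiagonal Jacobi matrix, rows and columns numbered `1, 2, 3, …`: the diagonal is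
`b₁, b₂, …` and the entries at `(i, i + 1)` and `(i + 1, i)` are `aᵢ`. -/
def matrix : Matrix ℕ+ ℕ+ ℝ := fun i j =>
  if i = j then J.b i
  else if j = i + 1 then J.a i
  else if i = j + 1 then J.a j
  else 0

/-- The transfer matrix `Bᵢ(lam)`, for `i ≥ 1`. -/
noncomputable def transfer (lam : ℝ) (i : ℕ) : Matrix (Fin 2) (Fin 2) ℝ :=
  !![0, 1; -(J.a (i - 1) / J.a i), (lam - J.b i) / J.a i]

/-- The product `B_k(lam) ⋯ B₁(lam)`. -/
noncomputable def transferProd (lam : ℝ) : ℕ → Matrix (Fin 2) (Fin 2) ℝ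
  | 0 => 1
  | k + 1 => J.transfer lam (k + 1) * transferProd lam k

/-- The monodromy matrix `M(lam) = B_T(lam) ⋯ B₁(lam)`. -/
noncomputable def monodromy (lam : ℝ) : Matrix (Fin 2) (Fin 2) ℝ :=
  J.transferProd lam T

/-- The generalised interior of the essential spectrum: the set of elliptic points. -/
def ellipticSet : Set ℝ := {lam | |(J.monodromy lam).trace| < 2}

/-- The quasi-momentum: for elliptic `lam`, the unique `θ ∈ (0, π)` such that `M(lam)` has the
eigenvalues `e^{iθ}` and `e^{-iθ}` (see `quasimomentum_spec` and `quasimomentum_unique`). -/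
noncomputable def quasimomentum (lam : ℝ) : ℝ :=
  Real.arccos ((J.monodromy lam).trace / 2)

lemma det_transferProd (lam : ℝ) (k : ℕ) : (J.transferProd lam k).det = J.a 0 / J.a k := by
  induction k with
  | zero => simp [transferProd, (J.a_pos 0).ne']
  | succ k ih =>
    have h1 := (J.a_pos k).ne'
    have h2 := (J.a_pos (k + 1)).ne'
    rw [transferProd, Matrix.det_mul, ih]
    simp only [transfer, Matrix.det_fin_two_of, Nat.add_sub_cancel]
    field_simp
    ring

lemma det_monodromy (lam : ℝ) : (J.monodromy lam).det = 1 := by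
  have h := J.a_periodic 0
  rw [zero_add] at h
  rw [monodromy, det_transferProd, h, div_self (J.a_pos 0).ne']

open Polynomial in
lemma quasimomentum_spec {lam : ℝ} (h : lam ∈ J.ellipticSet) :
    J.quasimomentum lam ∈ Set.Ioo 0 Real.pi ∧
    ((J.monodromy lam).map Complex.ofReal).charpoly =
      (X - C (Complex.exp (J.quasimomentum lam * Complex.I))) *
      (X - C (Complex.exp (-(J.quasimomentum lam * Complex.I)))) := by
  have h' : |(J.monodromy lam).trace| < 2 := h
  rw [abs_lt] at h'
  have hd := J.det_monodromy lam
  have hc : 2 * Real.cos (J.quasimomentum lam) = (J.monodromy lam).trace := by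
    rw [quasimomentum, Real.cos_arccos] <;> linarith
  refine ⟨⟨Real.arccos_pos.2 (by linarith), ?_⟩, ?_⟩
  · refine lt_of_le_of_ne (Real.arccos_le_pi _) fun he => ?_
    have := Real.arccos_eq_pi.1 he
    linarith
  · have hc' : Complex.exp (J.quasimomentum lam * Complex.I) +
        Complex.exp (-(J.quasimomentum lam * Complex.I)) =
        ((J.monodromy lam).map Complex.ofReal).trace := by
      rw [← neg_mul, ← Complex.two_cos, ← Complex.ofReal_cos]
      have : ((J.monodromy lam).map Complex.ofReal).trace
          = (((J.monodromy lam).trace : ℝ) : ℂ) := by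
        simp [Matrix.trace]
      rw [this, ← hc]
      push_cast
      ring
    have hd' : ((J.monodromy lam).map Complex.ofReal).det = 1 := by
      have := congrArg Complex.ofReal hd
      rw [Matrix.det_fin_two] at this ⊢
      simpa using this
    have he : Complex.exp (J.quasimomentum lam * Complex.I) *
        Complex.exp (-(J.quasimomentum lam * Complex.I)) = 1 := by
      rw [← Complex.exp_add]
      simp
    rw [Matrix.charpoly_fin_two, hd', ← hc', ← he]
    simp only [C_add, C_mul]
    ring

open Polynomial in
lemma quasimomentum_unique {lam θ : ℝ} (hθ : θ ∈ Set.Ioo 0 Real.pi)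
    (h : ((J.monodromy lam).map Complex.ofReal).charpoly =
      (X - C (Complex.exp (θ * Complex.I))) * (X - C (Complex.exp (-(θ * Complex.I))))) :
    J.quasimomentum lam = θ := by
  have ht : ((J.monodromy lam).map Complex.ofReal).trace
      = (((J.monodromy lam).trace : ℝ) : ℂ) := by
    simp [Matrix.trace]
  rw [Matrix.charpoly_fin_two, ht] at h
  have h1 := congrArg (fun P : ℂ[X] => P.eval 1 - P.eval 0) h
  have he : Complex.exp (θ * Complex.I) + Complex.exp (-(θ * Complex.I))
      = ((2 * Real.cos θ : ℝ) : ℂ) := by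
    rw [← neg_mul, ← Complex.two_cos]
    push_cast
    ring
  have h2 : (((J.monodromy lam).trace : ℝ) : ℂ) = ((2 * Real.cos θ : ℝ) : ℂ) := by
    rw [← he]
    simp at h1
    linear_combination -h1
  have h3 : (J.monodromy lam).trace = 2 * Real.cos θ := by exact_mod_cast h2
  rw [quasimomentum, h3, mul_div_cancel_left₀ _ two_ne_zero, Real.arccos_cos hθ.1.le hθ.2.le]

end PeriodicJacobi

/-- `lam` is an eigenvalue of the infinite real matrix `A` with a non-zero real eigenvector in `ℓ²`:
the sequence with entries `∑ⱼ Aᵢⱼ uⱼ` is `lam • u`. -/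
def HasL2Eigenvector (A : Matrix ℕ+ ℕ+ ℝ) (lam : ℝ) : Prop :=
  ∃ u : lp (fun _ : ℕ+ => ℝ) 2, u ≠ 0 ∧ ∀ i, HasSum (fun j => A i j * u j) (lam * u i)

/-! For elliptic `lam` let `(1, c)` be the left eigenvector of the monodromy matrix with eigenvalue
`e = exp(iθ)`. Sampling the solution with `u₀ = 0`, `u₁ = 1` once per period, `w = u_{kT} + c
u_{kT+1}` evolves by `w ↦ e (w + α q_k Im w)` with `α = 1 / (a₀ Im c)`: a small kick, then a
rotation. A kick `κ` changes `|w|²` by `κ α Im(w²) + O(κ²)`, so it contracts when the phase of `w²`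
is favourable.

The potential is chosen by feedback: it kicks only when finitely many active eigenvalues are all at
favourable phases, and vanishes otherwise, when all norms are conserved. The phases of `w²` turn by
`2θ`. Weyl equidistribution for the independent angles, a second-moment argument for each rational
one and the Chinese remainder theorem give a common favourable time within a bound `L` uniform in
the state (`exists_uniform_return_mixed`). Hence each window of length `L` contracts every active
`|w|²` by `1 - |α| κ / 4` (`kickedState_contract`).

On the block `[2^d, 2^(d+1))` the kick is `κ = H / 2^d`, with `H` so large that the block's `2^d /
L` windows give a factor `1/4`; then `|w|² = O(k⁻²)`. Each fixed `H` is eventually affordable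
because `K → ∞`, so the active set may grow, slowly enough, to include every eigenvalue
(`exists_potential_summable`). -/

/-! ### Simultaneous returns of rotations -/

open MeasureTheory UnitAddTorus in
/-- Weyl's criterion in its uniform form: if no nontrivial character of the torus is trivial at
`x`, then every orbit of the translation by `x` enters a given open set within a bounded time. -/
theorem exists_uniform_return_time {d : Type*} [Fintype d] (x : UnitAddTorus d)
    (hx : ∀ m : d → ℤ, m ≠ 0 → mFourier m x ≠ 1) {U : Set (UnitAddTorus d)} (hU : IsOpen U)
    {p : UnitAddTorus d} (hp : p ∈ U) :
    ∃ L : ℕ, ∀ y : UnitAddTorus d, ∃ t < L, y + t • x ∈ U := by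
  classical
  let μ : Measure (UnitAddTorus d) := Measure.addHaarMeasure ⊤
  have hμ : IsProbabilityMeasure μ := ⟨by
    have := Measure.addHaarMeasure_self (K₀ := (⊤ : TopologicalSpace.PositiveCompacts (UnitAddTorus d)))
    simpa using this⟩
  have hint : ∀ g : C(UnitAddTorus d, ℂ), Integrable g μ := fun g =>
    g.continuous.integrable_of_hasCompactSupport (HasCompactSupport.of_compactSpace _)
  -- trigonometric polynomials have bounded discrepancy
  have hbdd : ∀ g ∈ Submodule.span ℂ (Set.range (mFourier (d := d))), ∃ C : ℝ,
      ∀ (N : ℕ) (y : UnitAddTorus d),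
        ‖∑ t ∈ Finset.range N, (g (y + t • x) - ∫ z, g z ∂μ)‖ ≤ C := by
    intro g hg
    induction hg using Submodule.span_induction with
    | mem g hg =>
      obtain ⟨m, rfl⟩ := hg
      by_cases hm : m = 0
      · subst hm
        exact ⟨0, fun N y => by simp [mFourier_zero]⟩
      have hadd : ∀ y z : UnitAddTorus d, mFourier m (y + z) = mFourier m y * mFourier m z := by
        intro y z
        simp [mFourier, Finset.prod_mul_distrib, fourier_apply, smul_add, AddCircle.toCircle_add]
      -- Translation by `x` multiplies the integral by `mFourier m x ≠ 1`.
      have h0 : ∫ z, mFourier m z ∂μ = 0 := by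
        have h1 : ∫ z, mFourier m (z + x) ∂μ = ∫ z, mFourier m z ∂μ :=
          integral_add_right_eq_self (fun z => mFourier m z) x
        simp only [hadd] at h1
        rw [integral_mul_const] at h1
        have h2 : (∫ z, mFourier m z ∂μ) * (mFourier m x - 1) = 0 := by
          rw [mul_sub, h1]; ring
        exact (mul_eq_zero.1 h2).resolve_right (sub_ne_zero.2 (hx m hm))
      have hsm : ∀ t : ℕ, mFourier m (t • x) = mFourier m x ^ t := by
        intro t
        induction t with
        | zero => simp [mFourier, fourier_apply]
        | succ t ih => rw [succ_nsmul, hadd, ih, pow_succ]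
      have hn : ∀ y, ‖mFourier m y‖ ≤ 1 := fun y =>
        ((mFourier m).norm_coe_le_norm y).trans mFourier_norm.le
      -- The orbit sum is a geometric series; its bound depends on neither `N` nor `y`, which is the
      -- source of the uniformity.
      refine ⟨2 / ‖mFourier m x - 1‖, fun N y => ?_⟩
      simp only [h0, sub_zero, hadd, hsm]
      rw [← Finset.mul_sum, geom_sum_eq (hx m hm), norm_mul, norm_div]
      refine (mul_le_of_le_one_left (by positivity) (hn y)).trans ?_
      gcongr
      refine (norm_sub_le _ _).trans ?_
      rw [norm_pow, norm_one]
      have := pow_le_one₀ (norm_nonneg _) (hn x) (n := N)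
      linarith
    | zero => exact ⟨0, fun N y => by simp⟩
    | add f g _ _ hf hg =>
      obtain ⟨C, hC⟩ := hf
      obtain ⟨D, hD⟩ := hg
      refine ⟨C + D, fun N y => ?_⟩
      have : ∑ t ∈ Finset.range N, ((f + g) (y + t • x) - ∫ z, (f + g) z ∂μ) =
          ∑ t ∈ Finset.range N, (f (y + t • x) - ∫ z, f z ∂μ) +
          ∑ t ∈ Finset.range N, (g (y + t • x) - ∫ z, g z ∂μ) := by
        rw [← Finset.sum_add_distrib]
        refine Finset.sum_congr rfl fun t _ => ?_
        simp only [ContinuousMap.add_apply]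
        rw [integral_add (hint f) (hint g)]
        ring
      rw [this]
      exact (norm_add_le _ _).trans (add_le_add (hC N y) (hD N y))
    | smul c f _ hf =>
      obtain ⟨C, hC⟩ := hf
      refine ⟨‖c‖ * C, fun N y => ?_⟩
      have : ∑ t ∈ Finset.range N, ((c • f) (y + t • x) - ∫ z, (c • f) z ∂μ) =
          c * ∑ t ∈ Finset.range N, (f (y + t • x) - ∫ z, f z ∂μ) := by
        rw [Finset.mul_sum]
        refine Finset.sum_congr rfl fun t _ => ?_
        simp only [ContinuousMap.smul_apply, smul_eq_mul]
        rw [integral_const_mul]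
        ring
      rw [this, norm_mul]
      exact mul_le_mul_of_nonneg_left (hC N y) (norm_nonneg _)
  -- a bump function supported in `U`
  obtain ⟨f, hf0, hf1, hf01⟩ := exists_continuous_zero_one_of_isClosed hU.isClosed_compl
    (isClosed_singleton (x := p)) (by simpa using hp)
  have hfint : Integrable f μ :=
    f.continuous.integrable_of_hasCompactSupport (HasCompactSupport.of_compactSpace _)
  have hI : 0 < ∫ z, f z ∂μ := by
    refine f.continuous.integral_pos_of_hasCompactSupport_nonneg_nonzero
      (HasCompactSupport.of_compactSpace _) (fun z => (hf01 z).1) (x := p) ?_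
    rw [hf1 (Set.mem_singleton p)]
    exact one_ne_zero
  set I := ∫ z, f z ∂μ with hIdef
  let F : C(UnitAddTorus d, ℂ) := ⟨fun z => (f z : ℂ), by fun_prop⟩
  have hF : F ∈ (Submodule.span ℂ (Set.range (mFourier (d := d)))).topologicalClosure := by
    rw [span_mFourier_closure_eq_top]; trivial
  obtain ⟨g, hg, hFg⟩ := Metric.mem_closure_iff.1 hF (I / 3) (by positivity)
  obtain ⟨C, hC⟩ := hbdd g hg
  have hFg' : ∀ z, ‖F z - g z‖ ≤ I / 3 := fun z => by
    have := (F - g).norm_coe_le_norm z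
    rw [dist_eq_norm] at hFg
    exact this.trans hFg.le
  have hgI : ‖(I : ℂ) - ∫ z, g z ∂μ‖ ≤ I / 3 := by
    have h1 : (I : ℂ) = ∫ z, F z ∂μ := by
      rw [hIdef]; exact (integral_ofReal).symm
    rw [h1, ← integral_sub (hint F) (hint g)]
    refine (norm_integral_le_of_norm_le_const (Eventually.of_forall hFg')).trans ?_
    simp
  -- An orbit missing `U` for `L` steps has `F = 0` along it, which would force `L * I ≤ C + 2 * L *
  -- I / 3`.
  obtain ⟨L, hL⟩ := exists_nat_gt (C / (I / 3))
  refine ⟨L, fun y => ?_⟩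
  by_contra! hcon
  have hz : ∀ t < L, F (y + t • x) = 0 := fun t ht => by
    have := hf0 (hcon t ht)
    change ((f (y + t • x) : ℝ) : ℂ) = 0
    rw [this]; simp
  have h1 : ∀ t ∈ Finset.range L, ‖(g (y + t • x) - ∫ z, g z ∂μ) + (I : ℂ)‖ ≤ 2 * (I / 3) := by
    intro t ht
    have e : (g (y + t • x) - ∫ z, g z ∂μ) + (I : ℂ) =
        -(F (y + t • x) - g (y + t • x)) + ((I : ℂ) - ∫ z, g z ∂μ) := by
      rw [hz t (Finset.mem_range.1 ht)]; ring
    rw [e]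
    refine (norm_add_le _ _).trans ?_
    rw [norm_neg]
    have := hFg' (y + t • x)
    linarith
  have h2 := (norm_sum_le _ _).trans (Finset.sum_le_sum h1)
  rw [Finset.sum_add_distrib] at h2
  simp only [Finset.sum_const, Finset.card_range, nsmul_eq_mul] at h2
  have h3 := hC L y
  have h4 : ‖(L : ℂ) * (I : ℂ)‖ = L * I := by
    rw [norm_mul, Complex.norm_natCast, Complex.norm_real, Real.norm_of_nonneg hI.le]
  have h5 := norm_sub_le
    (∑ t ∈ Finset.range L, (g (y + t • x) - ∫ z, g z ∂μ) + (L : ℂ) * (I : ℂ))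
    (∑ t ∈ Finset.range L, (g (y + t • x) - ∫ z, g z ∂μ))
  rw [add_sub_cancel_left, h4] at h5
  rw [div_lt_iff₀ (by positivity)] at hL
  linarith

/-- Kronecker's theorem for rotations: if `1, γ₁, …, γ_N` are rationally independent, the numbers
`z_j e^{2πisγ_j}` are simultaneously close to the positive imaginary axis for some `s` below a
bound that does not depend on the `z_j`. -/
theorem exists_uniform_return_of_independent {d : Type*} [Fintype d] (γ : d → ℝ)
    (hγ : ∀ m : d → ℤ, m ≠ 0 → ∀ l : ℤ, ∑ j, m j * γ j ≠ l) :
    ∃ L : ℕ, ∀ z : d → ℂ, ∃ s < L, ∀ j,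
      ‖z j‖ / 2 ≤ (z j * Complex.exp (2 * Real.pi * Complex.I * γ j) ^ s).im := by
  have hx : ∀ m : d → ℤ, m ≠ 0 →
      UnitAddTorus.mFourier m (fun j => ((γ j : ℝ) : UnitAddCircle)) ≠ 1 := by
    intro m hm he
    have h1 : UnitAddTorus.mFourier m (fun j => ((γ j : ℝ) : UnitAddCircle)) =
        Complex.exp (((∑ j, m j * γ j : ℝ) : ℂ) * (2 * Real.pi * Complex.I)) := by
      simp only [UnitAddTorus.mFourier, ContinuousMap.coe_mk, fourier_coe_apply]
      rw [← Complex.exp_sum]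
      push_cast
      rw [Finset.sum_mul]
      congr 1
      refine Finset.sum_congr rfl fun j _ => ?_
      ring
    rw [h1, Complex.exp_eq_one_iff] at he
    obtain ⟨l, hl⟩ := he
    have h2 : (2 * Real.pi * Complex.I : ℂ) ≠ 0 := by simp [Real.pi_ne_zero]
    have h3 := mul_right_cancel₀ h2 hl
    exact hγ m hm l (by exact_mod_cast h3)
  have hU : IsOpen {y : UnitAddTorus d | ∀ j, 1 / 2 < (fourier 1 (y j) : ℂ).im} := by
    simp only [Set.ofPred_forall]
    refine isOpen_iInter_of_finite fun j => isOpen_lt continuous_const ?_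
    exact Complex.continuous_im.comp ((fourier 1).continuous.comp (continuous_apply j))
  have hp : (fun _ => ((1 / 4 : ℝ) : UnitAddCircle)) ∈
      {y : UnitAddTorus d | ∀ j, 1 / 2 < (fourier 1 (y j) : ℂ).im} := by
    intro j
    rw [fourier_coe_apply]
    have : (2 * Real.pi * Complex.I * (1 : ℤ) * ((1 / 4 : ℝ) : ℂ) / (1 : ℝ) : ℂ) =
        ((Real.pi / 2 : ℝ) : ℂ) * Complex.I := by push_cast; ring
    rw [this, Complex.exp_ofReal_mul_I_im, Real.sin_pi_div_two]
    norm_num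
  obtain ⟨L, hL⟩ := exists_uniform_return_time _ hx hU hp
  refine ⟨L, fun z => ?_⟩
  obtain ⟨s, hs, hsU⟩ := hL fun j => (((z j).arg / (2 * Real.pi) : ℝ) : UnitAddCircle)
  refine ⟨s, hs, fun j => ?_⟩
  have h1 := hsU j
  have h2 : (fourier 1 ((fun j => (((z j).arg / (2 * Real.pi) : ℝ) : UnitAddCircle)) j +
      (s • fun j => ((γ j : ℝ) : UnitAddCircle)) j) : ℂ) =
      Complex.exp ((z j).arg * Complex.I) * Complex.exp (2 * Real.pi * Complex.I * γ j) ^ s := by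
    rw [← Complex.exp_nat_mul, ← Complex.exp_add]
    simp only [Pi.smul_apply]
    rw [← AddCircle.coe_nsmul, ← AddCircle.coe_add, fourier_coe_apply]
    congr 1
    have : (Real.pi : ℂ) ≠ 0 := by simp [Real.pi_ne_zero]
    push_cast
    field_simp
    simp
    ring
  simp only [Pi.add_apply] at h1
  rw [h2] at h1
  have h3 : z j * Complex.exp (2 * Real.pi * Complex.I * γ j) ^ s = (‖z j‖ : ℂ) *
      (Complex.exp ((z j).arg * Complex.I) * Complex.exp (2 * Real.pi * Complex.I * γ j) ^ s) := by
    rw [← mul_assoc, Complex.norm_mul_exp_arg_mul_I]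
  rw [h3, Complex.im_ofReal_mul]
  have h4 := norm_nonneg (z j)
  nlinarith

/-- A rotation of finite order at least three brings every complex number close to the positive
imaginary axis. -/
theorem exists_return_of_pow_eq_one {ζ : ℂ} {q : ℕ} (hq : 0 < q) (hζ : ζ ^ q = 1)
    (hζ2 : ζ ^ 2 ≠ 1) (z : ℂ) : ∃ t < q, ‖z‖ / 2 ≤ (z * ζ ^ t).im := by
  by_contra! hcon
  have hn : ‖ζ‖ = 1 := Complex.norm_eq_one_of_pow_eq_one hζ hq.ne'
  have hζ1 : ζ ≠ 1 := by rintro rfl; simp at hζ2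
  have s1 : ∑ t ∈ Finset.range q, z * ζ ^ t = 0 := by
    rw [← Finset.mul_sum, geom_sum_eq hζ1, hζ]; simp
  have s2 : ∑ t ∈ Finset.range q, (z * ζ ^ t) ^ 2 = 0 := by
    simp only [mul_pow, ← pow_mul, mul_comm _ 2]
    simp only [pow_mul]
    rw [← Finset.mul_sum, geom_sum_eq hζ2, ← pow_mul, mul_comm 2 q, pow_mul, hζ]; simp
  have hnt : ∀ t, ‖z * ζ ^ t‖ = ‖z‖ := fun t => by rw [norm_mul, norm_pow, hn]; simp
  have i1 : ∑ t ∈ Finset.range q, (z * ζ ^ t).im = 0 := by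
    rw [← Complex.im_sum, s1]; rfl
  have i2 : ∑ t ∈ Finset.range q, (z * ζ ^ t).im ^ 2 = q * (‖z‖ ^ 2 / 2) := by
    have h1 : ∀ t, (z * ζ ^ t).im ^ 2 = ‖z‖ ^ 2 / 2 - ((z * ζ ^ t) ^ 2).re / 2 := fun t => by
      have := Complex.sq_norm (z * ζ ^ t)
      rw [hnt, Complex.normSq_apply] at this
      rw [sq (z * ζ ^ t), Complex.mul_re]
      linarith
    simp only [h1]
    rw [Finset.sum_sub_distrib, ← Finset.sum_div (f := fun t => ((z * ζ ^ t) ^ 2).re),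
      ← Complex.re_sum, s2]
    simp
  -- The imaginary parts have mean `0` and mean square `‖z‖² / 2`, so these products sum to zero. If
  -- all were below `‖z‖ / 2`, each factor would be nonnegative and every imaginary part would equal
  -- `-‖z‖`, against mean zero.
  have hsum : ∑ t ∈ Finset.range q, (‖z‖ / 2 - (z * ζ ^ t).im) * ((z * ζ ^ t).im + ‖z‖) = 0 := by
    have h1 : ∀ t, (‖z‖ / 2 - (z * ζ ^ t).im) * ((z * ζ ^ t).im + ‖z‖) =
        ‖z‖ ^ 2 / 2 - ‖z‖ / 2 * (z * ζ ^ t).im - (z * ζ ^ t).im ^ 2 := fun t => by ring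
    simp only [h1]
    rw [Finset.sum_sub_distrib, Finset.sum_sub_distrib, ← Finset.mul_sum, i1, i2]
    simp
  have hlow : ∀ t, -‖z‖ ≤ (z * ζ ^ t).im := fun t => by
    have := (abs_le.1 (Complex.abs_im_le_norm (z * ζ ^ t))).1
    rwa [hnt] at this
  have hall := (Finset.sum_eq_zero_iff_of_nonneg fun t ht => mul_nonneg
    (sub_nonneg.2 (hcon t (Finset.mem_range.1 ht)).le) (by linarith [hlow t])).1 hsum
  have him : ∀ t ∈ Finset.range q, (z * ζ ^ t).im = -‖z‖ := fun t ht => by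
    have h1 := sub_pos.2 (hcon t (Finset.mem_range.1 ht))
    have := (mul_eq_zero.1 (hall t ht)).resolve_left h1.ne'
    linarith
  rw [Finset.sum_congr rfl him] at i1
  have hz : ‖z‖ = 0 := by simpa [hq.ne'] using i1
  have := hcon 0 hq
  rw [norm_eq_zero.1 hz] at this
  simp at this

/-- Simultaneous return for finitely many rotations of pairwise coprime orders and finitely many
rationally independent rotations. -/
theorem exists_uniform_return_mixed {n : ℕ} {d : Type*} [Fintype d] (ζ : Fin n → ℂ)
    (q : Fin n → ℕ) (hq : ∀ i, 0 < q i) (hζ : ∀ i, ζ i ^ q i = 1) (hζ2 : ∀ i, ζ i ^ 2 ≠ 1)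
    (hcop : ∀ i j, i ≠ j → Nat.Coprime (q i) (q j)) (γ : d → ℝ)
    (hγ : ∀ m : d → ℤ, m ≠ 0 → ∀ l : ℤ, ∑ j, m j * γ j ≠ l) :
    ∃ L : ℕ, ∀ (z : Fin n → ℂ) (y : d → ℂ), ∃ t < L,
      (∀ i, ‖z i‖ / 2 ≤ (z i * ζ i ^ t).im) ∧
      ∀ j, ‖y j‖ / 2 ≤ (y j * Complex.exp (2 * Real.pi * Complex.I * γ j) ^ t).im := by
  set Q := ∏ i, q i with hQ
  have hQ0 : 0 < Q := Finset.prod_pos fun i _ => hq i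
  obtain ⟨L, hL⟩ := exists_uniform_return_of_independent (fun j => (Q : ℝ) * γ j) (by
    intro m hm l hl
    refine hγ (fun j => Q * m j) (fun h => hm ?_) l ?_
    · ext j
      have := congrFun h j
      simpa [hQ0.ne'] using this
    · rw [← hl]
      refine Finset.sum_congr rfl fun j _ => ?_
      push_cast
      ring)
  refine ⟨Q + Q * L, fun z y => ?_⟩
  choose r _ hr using fun i => exists_return_of_pow_eq_one (hq i) (hζ i) (hζ2 i) (z i)
  -- Time `c` aligns all finite-order rotations at once. Waiting further multiples of `Q` does not
  -- move them, and the angles `Q * γ j`, still independent, align the rest.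
  let c := Nat.chineseRemainderOfFinset r q Finset.univ (fun i _ => (hq i).ne')
    (fun i _ j _ hij => hcop i j hij)
  have hc : (c : ℕ) < Q := Nat.chineseRemainderOfFinset_lt_prod r q (fun i _ => (hq i).ne')
    (fun i _ j _ hij => hcop i j hij)
  obtain ⟨s, hs, hsy⟩ := hL fun j => y j * Complex.exp (2 * Real.pi * Complex.I * γ j) ^ (c : ℕ)
  refine ⟨c + Q * s, add_lt_add hc (Nat.mul_lt_mul_of_pos_left hs hQ0), fun i => ?_, fun j => ?_⟩
  · have h1 : ζ i ^ ((c : ℕ) + Q * s) = ζ i ^ r i := by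
      have h2 : ζ i ^ Q = 1 := by
        obtain ⟨k, hk⟩ := Finset.dvd_prod_of_mem q (Finset.mem_univ i)
        rw [hQ, hk, pow_mul, hζ, one_pow]
      have h3 : (c : ℕ) % q i = r i % q i := c.2 i (Finset.mem_univ i)
      rw [pow_add, pow_mul, h2, one_pow, mul_one, pow_eq_pow_mod _ (hζ i), h3,
        ← pow_eq_pow_mod _ (hζ i)]
    rw [h1]
    exact hr i
  · have h1 := hsy j
    have h2 : ‖Complex.exp (2 * Real.pi * Complex.I * γ j)‖ = 1 := by
      have : (2 * Real.pi * Complex.I * γ j : ℂ) = ((2 * Real.pi * γ j : ℝ) : ℂ) * Complex.I := by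
        push_cast; ring
      rw [this, Complex.norm_exp_ofReal_mul_I]
    have h3 : Complex.exp (2 * Real.pi * Complex.I * ((Q * γ j : ℝ) : ℂ)) =
        Complex.exp (2 * Real.pi * Complex.I * γ j) ^ Q := by
      rw [← Complex.exp_nat_mul]
      congr 1
      push_cast
      ring
    rw [norm_mul, norm_pow, h2, one_pow, mul_one, h3, mul_assoc, ← pow_mul, ← pow_add] at h1
    exact h1

/-! ### Slow stages, the gain of one kick, dyadic summability -/

/-- Diagonal choice of a slowly growing stage. -/
theorem exists_slow_stage {P : ℕ → ℕ → Prop} (hP : ∀ N, ∀ᶠ d in atTop, P N d) :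
    ∃ N : ℕ → ℕ, Tendsto N atTop atTop ∧ ∀ d, N d ≠ 0 → P (N d) d := by
  choose τ hτ using fun N => eventually_atTop.1 (hP N)
  refine ⟨fun d => Nat.findGreatest (fun N => τ N ≤ d) d, tendsto_atTop.2 fun M => ?_,
    fun d hd => ?_⟩
  · filter_upwards [eventually_ge_atTop (max M (τ M))] with d hd
    exact Nat.le_findGreatest ((le_max_left _ _).trans hd) ((le_max_right _ _).trans hd)
  · exact hτ _ _ (Nat.findGreatest_of_ne_zero (P := fun N => τ N ≤ d) rfl hd)

/-- The effect of a kick at a favourable phase. -/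
theorem norm_sq_kick_le {e w : ℂ} {α κ : ℝ} (he : ‖e‖ = 1) (hκ : 0 ≤ κ) (hακ : |α| * κ ≤ 1 / 4)
    (hw : α * (w ^ 2).im ≤ -(|α| * ‖w‖ ^ 2 / 2)) :
    ‖e * (w + ((α * κ * w.im : ℝ) : ℂ))‖ ^ 2 ≤ (1 - |α| * κ / 4) * ‖w‖ ^ 2 := by
  rw [norm_mul, he, one_mul]
  have h1 : ‖w‖ ^ 2 = w.re ^ 2 + w.im ^ 2 := by
    rw [Complex.sq_norm, Complex.normSq_apply]; ring
  have h2 : ‖w + ((α * κ * w.im : ℝ) : ℂ)‖ ^ 2 =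
      ‖w‖ ^ 2 + κ * (α * (w ^ 2).im) + (|α| * κ) ^ 2 * w.im ^ 2 := by
    rw [h1, Complex.sq_norm, Complex.normSq_apply, mul_pow, sq_abs, sq w, Complex.mul_im]
    simp only [Complex.add_re, Complex.add_im, Complex.ofReal_re, Complex.ofReal_im]
    ring
  -- The first-order gain is `|α| κ / 2`; as `|α| κ ≤ 1/4`, the quadratic term costs at most half of
  -- it.
  have h3 : κ * (α * (w ^ 2).im) ≤ κ * (-(|α| * ‖w‖ ^ 2 / 2)) := mul_le_mul_of_nonneg_left hw hκ
  have h4 : 0 ≤ |α| * κ := by positivity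
  have h5 : (|α| * κ) ^ 2 * w.im ^ 2 ≤ |α| * κ * (1 / 4) * ‖w‖ ^ 2 := by
    have h6 : w.im ^ 2 ≤ ‖w‖ ^ 2 := by rw [h1]; nlinarith [sq_nonneg w.re]
    have h7 : (|α| * κ) ^ 2 ≤ |α| * κ * (1 / 4) := by nlinarith
    exact mul_le_mul h7 h6 (sq_nonneg _) (by positivity)
  rw [h2]
  nlinarith

/-- Since `(1 - x)(1 + x) ≤ 1`, it suffices that Bernoulli gives `(1 + x)^m ≥ 1 + m x ≥ 4`. -/
theorem one_sub_pow_le_quarter {x : ℝ} {m : ℕ} (hx0 : 0 ≤ x) (hx1 : x ≤ 1) (hm : 3 ≤ m * x) :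
    (1 - x) ^ m ≤ 1 / 4 := by
  have h1 : (1 - x) ^ m * (1 + x) ^ m ≤ 1 := by
    rw [← mul_pow]
    exact pow_le_one₀ (by nlinarith) (by nlinarith)
  have h2 := one_add_mul_le_pow (a := x) (by linarith) m
  have h3 : 0 ≤ (1 - x) ^ m := pow_nonneg (by linarith) m
  nlinarith

/-- A nonnegative sequence that is eventually nonincreasing on dyadic blocks and drops by a factor
of four over each of them is summable. -/
theorem summable_of_dyadic_quarter {f : ℕ → ℝ} (hf : ∀ k, 0 ≤ f k) {D : ℕ}
    (hmono : ∀ d ≥ D, ∀ k, 2 ^ d ≤ k → k < 2 ^ (d + 1) → f k ≤ f (2 ^ d))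
    (hdrop : ∀ d ≥ D, f (2 ^ (d + 1)) ≤ f (2 ^ d) / 4) : Summable f := by
  have h1 : ∀ j, f (2 ^ (D + j)) ≤ f (2 ^ D) * (1 / 4) ^ j := by
    intro j
    induction j with
    | zero => simp
    | succ j ih =>
      have := hdrop (D + j) (by omega)
      rw [← add_assoc, pow_succ (1 / 4 : ℝ)]
      linarith
  -- In the block of `2^(D+j)` the bound `4^(-j)` is at most `4^(D+1) / k²`, because `k <
  -- 2^(D+j+1)`.
  refine Summable.of_norm_bounded_eventually_nat (g := fun k : ℕ =>
    (f (2 ^ D) * 4 ^ (D + 1)) * (1 / (k : ℝ) ^ 2))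
    ((Real.summable_one_div_nat_pow.2 one_lt_two).mul_left _) ?_
  filter_upwards [eventually_ge_atTop (2 ^ D)] with k hk
  have hk0 : k ≠ 0 := by have := Nat.two_pow_pos D; omega
  have hd1 : 2 ^ Nat.log 2 k ≤ k := Nat.pow_log_le_self 2 hk0
  have hd2 : k < 2 ^ (Nat.log 2 k + 1) := Nat.lt_pow_succ_log_self one_lt_two k
  obtain ⟨j, hj⟩ := Nat.exists_eq_add_of_le (Nat.le_log_of_pow_le one_lt_two hk)
  rw [hj] at hd1 hd2
  rw [Real.norm_of_nonneg (hf k)]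
  refine (hmono _ (by omega) k hd1 hd2).trans ((h1 j).trans ?_)
  rw [mul_assoc]
  refine mul_le_mul_of_nonneg_left ?_ (hf _)
  have hk' : (0 : ℝ) < k := by positivity
  rw [mul_one_div, le_div_iff₀ (by positivity)]
  have h2 : (k : ℝ) ^ 2 ≤ (2 ^ (D + j + 1)) ^ 2 := by
    gcongr
    exact_mod_cast hd2.le
  have h3 : ((2 : ℝ) ^ (D + j + 1)) ^ 2 = 4 ^ (D + 1) * 4 ^ j := by
    rw [← pow_mul, mul_comm, pow_mul, ← pow_add]
    norm_num
    ring
  have h4 : ((1 : ℝ) / 4) ^ j * 4 ^ j = 1 := by rw [← mul_pow]; norm_num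
  calc ((1 : ℝ) / 4) ^ j * (k : ℝ) ^ 2 ≤ (1 / 4) ^ j * (4 ^ (D + 1) * 4 ^ j) := by
        rw [← h3]; gcongr
    _ = 4 ^ (D + 1) * ((1 / 4) ^ j * 4 ^ j) := by ring
    _ = 4 ^ (D + 1) := by rw [h4, mul_one]

/-! ### Greedy feedback and the choice of the potential -/

/-- The evolution of the states under the feedback rule `Q` for the potential. -/
noncomputable def kickedState {ι : Type*} (e : ι → ℂ) (α : ι → ℝ) (w₀ : ι → ℂ)
    (Q : ℕ → (ι → ℂ) → ℝ) : ℕ → ι → ℂ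
  | 0 => w₀
  | k + 1 => fun i => e i * (kickedState e α w₀ Q k i +
      ((α i * Q k (kickedState e α w₀ Q k) * (kickedState e α w₀ Q k i).im : ℝ) : ℂ))

/-- Over a time span containing a favourable time, the greedy rule contracts. -/
theorem kickedState_contract {ι : Type*} {e : ι → ℂ} {α : ι → ℝ} {w₀ : ι → ℂ}
    {Q : ℕ → (ι → ℂ) → ℝ} (he : ∀ i, ‖e i‖ = 1) {S : Finset ι} {κ : ℝ} {a b L : ℕ} (hκ : 0 ≤ κ)
    (hακ : ∀ i ∈ S, |α i| * κ ≤ 1 / 4)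
    (hQ : ∀ k, a ≤ k → k < b → ∀ w : ι → ℂ,
      ((∀ i ∈ S, α i * (w i ^ 2).im ≤ -(|α i| * ‖w i‖ ^ 2 / 2)) → Q k w = κ) ∧
      ((¬ ∀ i ∈ S, α i * (w i ^ 2).im ≤ -(|α i| * ‖w i‖ ^ 2 / 2)) → Q k w = 0))
    (hret : ∀ z : ι → ℂ, ∃ t < L, ∀ i ∈ S, ‖z i‖ / 2 ≤ (z i * (e i ^ 2) ^ t).im) :
    (∀ i ∈ S, ∀ k, a ≤ k → k < b →
      ‖kickedState e α w₀ Q (k + 1) i‖ ^ 2 ≤ ‖kickedState e α w₀ Q k i‖ ^ 2) ∧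
    ∀ i ∈ S, ∀ k, a ≤ k → k + L ≤ b → ‖kickedState e α w₀ Q (k + L) i‖ ^ 2 ≤
      (1 - |α i| * κ / 4) * ‖kickedState e α w₀ Q k i‖ ^ 2 := by
  set W := kickedState e α w₀ Q with hW
  have hstep : ∀ k i, W (k + 1) i = e i * (W k i + ((α i * Q k (W k) * (W k i).im : ℝ) : ℂ)) :=
    fun k i => rfl
  have hkick : ∀ k, a ≤ k → k < b →
      (∀ i ∈ S, α i * (W k i ^ 2).im ≤ -(|α i| * ‖W k i‖ ^ 2 / 2)) → ∀ i ∈ S,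
      ‖W (k + 1) i‖ ^ 2 ≤ (1 - |α i| * κ / 4) * ‖W k i‖ ^ 2 := by
    intro k hk1 hk2 hg i hi
    rw [hstep, (hQ k hk1 hk2 _).1 hg]
    exact norm_sq_kick_le (he i) hκ (hακ i hi) (hg i hi)
  have hfree : ∀ k, a ≤ k → k < b →
      (¬ ∀ i ∈ S, α i * (W k i ^ 2).im ≤ -(|α i| * ‖W k i‖ ^ 2 / 2)) → ∀ i,
      W (k + 1) i = e i * W k i := by
    intro k hk1 hk2 hg i
    rw [hstep, (hQ k hk1 hk2 _).2 hg]
    simp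
  have hmono : ∀ i ∈ S, ∀ k, a ≤ k → k < b → ‖W (k + 1) i‖ ^ 2 ≤ ‖W k i‖ ^ 2 := by
    intro i hi k hk1 hk2
    by_cases hg : ∀ i ∈ S, α i * (W k i ^ 2).im ≤ -(|α i| * ‖W k i‖ ^ 2 / 2)
    · refine (hkick k hk1 hk2 hg i hi).trans ?_
      have : 0 ≤ |α i| * κ := by positivity
      nlinarith [sq_nonneg ‖W k i‖]
    · rw [hfree k hk1 hk2 hg, norm_mul, he, one_mul]
  have hmono' : ∀ i ∈ S, ∀ k, a ≤ k → ∀ s, k + s ≤ b → ‖W (k + s) i‖ ^ 2 ≤ ‖W k i‖ ^ 2 := by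
    intro i hi k hk s
    induction s with
    | zero => intro _; exact le_rfl
    | succ s ih =>
      intro hs
      exact (hmono i hi (k + s) (by omega) (by omega)).trans (ih (by omega))
  refine ⟨hmono, fun i hi k hk1 hk2 => ?_⟩
  -- The sign turns the return to the positive imaginary axis into the favourable condition on `α *
  -- Im(w²)`.
  obtain ⟨t, ht, hgood⟩ := hret fun i => -((SignType.sign (α i) : ℝ) : ℂ) * W k i ^ 2
  -- With no favourable time up to `t`, no kick would have occurred, so the motion would be a pure
  -- rotation and time `t` itself would be favourable.
  have hex : ∃ s ≤ t, ∀ i ∈ S, α i * (W (k + s) i ^ 2).im ≤ -(|α i| * ‖W (k + s) i‖ ^ 2 / 2) := by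
    by_contra! hcon
    have hrot : ∀ s ≤ t, ∀ i, W (k + s) i = e i ^ s * W k i := by
      intro s
      induction s with
      | zero => intro _ i; simp
      | succ s ih =>
        intro hs i
        have hng : ¬ ∀ i ∈ S, α i * (W (k + s) i ^ 2).im ≤
            -(|α i| * ‖W (k + s) i‖ ^ 2 / 2) := by
          push Not
          exact hcon s (by omega)
        rw [← add_assoc, hfree (k + s) (by omega) (by omega) hng, ih (by omega), pow_succ]
        ring
    obtain ⟨i, hi, hlt⟩ := hcon t le_rfl
    have h1 := hgood i hi
    have h2 : ‖W (k + t) i‖ = ‖W k i‖ := by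
      rw [hrot t le_rfl, norm_mul, norm_pow, he, one_pow, one_mul]
    have h3 : (-((SignType.sign (α i) : ℝ) : ℂ) * W k i ^ 2) * (e i ^ 2) ^ t =
        ((-(SignType.sign (α i) : ℝ) : ℝ) : ℂ) * W (k + t) i ^ 2 := by
      rw [hrot t le_rfl]; push_cast; ring
    rw [h3, Complex.im_ofReal_mul] at h1
    have h4 := mul_le_mul_of_nonneg_left h1 (abs_nonneg (α i))
    have h5 : |α i| * (-(SignType.sign (α i) : ℝ) * (W (k + t) i ^ 2).im) =
        -(α i * (W (k + t) i ^ 2).im) := by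
      conv_rhs => rw [← sign_mul_abs (α i)]
      ring
    rw [h5] at h4
    rw [h2] at hlt
    rcases eq_or_ne (α i) 0 with h0 | h0
    · simp [h0] at hlt
    · have h6 : ‖-((SignType.sign (α i) : ℝ) : ℂ) * W k i ^ 2‖ = ‖W k i‖ ^ 2 := by
        rcases lt_or_gt_of_ne h0 with h | h
        · simp [sign_neg h]
        · simp [sign_pos h]
      rw [h6] at h4
      linarith
  obtain ⟨s, hs, hg⟩ := hex
  have h1 := hkick (k + s) (by omega) (by omega) hg i hi
  have h2 := hmono' i hi k hk1 s (by omega)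
  have h3 := hmono' i hi (k + s + 1) (by omega) (L - (s + 1)) (by omega)
  rw [show k + s + 1 + (L - (s + 1)) = k + L by omega] at h3
  refine h3.trans (h1.trans (mul_le_mul_of_nonneg_left h2 ?_))
  have := hακ i hi
  linarith

/-- A single small potential makes countably many kicked rotations square summable, as soon as any
finite subfamily returns simultaneously to favourable phases within bounded time. -/
theorem exists_potential_summable {ι : Type*} (e : ι → ℂ) (α : ι → ℝ) (w₀ : ι → ℂ)
    (he : ∀ i, ‖e i‖ = 1) (hα : ∀ i, α i ≠ 0) (S : ℕ → Finset ι)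
    (hS : ∀ i, ∀ᶠ N in atTop, i ∈ S N)
    (hret : ∀ N, ∃ L : ℕ, ∀ z : ι → ℂ, ∃ t < L, ∀ i ∈ S N,
      ‖z i‖ / 2 ≤ (z i * (e i ^ 2) ^ t).im)
    (g : ℕ → ℝ) (hg : ∀ k, 0 ≤ g k) (hg' : Tendsto (fun k : ℕ => k * g k) atTop atTop) :
    ∃ q : ℕ → ℝ, (∀ k, |q k| ≤ g k) ∧ Tendsto q atTop (𝓝 0) ∧
      ∀ i (w : ℕ → ℂ), w 0 = w₀ i →
        (∀ k, w (k + 1) = e i * (w k + ((α i * q k * (w k).im : ℝ) : ℂ))) →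
        Summable fun k => ‖w k‖ ^ 2 := by
  classical
  -- Window lengths are rounded up to powers of two so that they tile dyadic blocks exactly.
  have hret' : ∀ N, ∃ l : ℕ, ∀ z : ι → ℂ, ∃ t < 2 ^ l, ∀ i ∈ S N,
      ‖z i‖ / 2 ≤ (z i * (e i ^ 2) ^ t).im := by
    intro N
    obtain ⟨L, hL⟩ := hret N
    refine ⟨L, fun z => ?_⟩
    obtain ⟨t, ht, h⟩ := hL z
    exact ⟨t, ht.trans Nat.lt_two_pow_self, h⟩
  choose l hl using hret'
  -- With `2^(d-l)` windows and `x = |α| H / (4 * 2^d)`, the constant `12` is what makes (number of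
  -- windows) times `x` at least `3`.
  have hH : ∀ N, ∃ H : ℝ, 0 ≤ H ∧ ∀ i ∈ S N, 12 * 2 ^ l N ≤ |α i| * H := by
    intro N
    have h1 : ∀ᶠ H : ℝ in atTop, ∀ i ∈ S N, 12 * 2 ^ l N ≤ |α i| * H :=
      (Finset.eventually_all (S N)).2 fun i _ =>
        (tendsto_id.const_mul_atTop (abs_pos.2 (hα i))).eventually_ge_atTop _
    exact ((eventually_ge_atTop 0).and h1).exists
  choose H hH0 hH1 using hH
  have hpow : Tendsto (fun d : ℕ => (2 : ℝ) ^ d) atTop atTop :=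
    tendsto_pow_atTop_atTop_of_one_lt one_lt_two
  have hpowN : Tendsto (fun d : ℕ => 2 ^ d) atTop atTop :=
    tendsto_pow_atTop_atTop_of_one_lt one_lt_two
  -- The demands on a block: windows fit; `H / 2^d ≤ 2 * H / k ≤ g k`; kicks are small enough to
  -- contract; and the potential tends to zero, which `g` alone need not ensure.
  obtain ⟨stage, hstage, hP⟩ := exists_slow_stage (P := fun N d => l N < d ∧
      (∀ k : ℕ, 2 ^ d ≤ k → 2 * H N ≤ k * g k) ∧ (∀ i ∈ S N, |α i| * (H N / 2 ^ d) ≤ 1 / 4) ∧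
      H N / 2 ^ d ≤ 1 / (N + 1)) (by
    intro N
    have hlim : Tendsto (fun d : ℕ => H N / 2 ^ d) atTop (𝓝 0) := hpow.const_div_atTop _
    refine (eventually_gt_atTop _).and (Eventually.and ?_ (Eventually.and ?_ ?_))
    · obtain ⟨k₀, hk₀⟩ := eventually_atTop.1 (hg'.eventually_ge_atTop (2 * H N))
      filter_upwards [hpowN.eventually_ge_atTop k₀] with d hd k hk
      exact hk₀ k (hd.trans hk)
    · refine (Finset.eventually_all (S N)).2 fun i _ => ?_
      have := hlim.const_mul |α i|
      rw [mul_zero] at this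
      exact this.eventually_le_const (by norm_num)
    · exact hlim.eventually_le_const (by positivity))
  -- Stage `0` carries no guarantee, so the potential is switched off there.
  let κ : ℕ → ℝ := fun d => if stage d = 0 then 0 else H (stage d) / 2 ^ d
  have hκ0 : ∀ d, 0 ≤ κ d := fun d => by
    simp only [κ]
    split_ifs
    · exact le_rfl
    · have := hH0 (stage d); positivity
  let Q : ℕ → (ι → ℂ) → ℝ := fun k w =>
    if ∀ i ∈ S (stage (Nat.log 2 k)), α i * (w i ^ 2).im ≤ -(|α i| * ‖w i‖ ^ 2 / 2)
    then κ (Nat.log 2 k) else 0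
  have hQ : ∀ k w, 0 ≤ Q k w ∧ Q k w ≤ κ (Nat.log 2 k) := fun k w => by
    simp only [Q]
    split_ifs
    · exact ⟨hκ0 _, le_rfl⟩
    · exact ⟨le_rfl, hκ0 _⟩
  have hlog : ∀ d k, 2 ^ d ≤ k → k < 2 ^ (d + 1) → Nat.log 2 k = d := fun d k h1 h2 =>
    Nat.log_eq_of_pow_le_of_lt_pow h1 h2
  set W := kickedState e α w₀ Q with hW
  have hκlim : Tendsto κ atTop (𝓝 0) := by
    have h1 : Tendsto (fun d => 1 / ((stage d : ℝ) + 1)) atTop (𝓝 0) :=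
      tendsto_one_div_add_atTop_nhds_zero_nat.comp hstage
    refine squeeze_zero hκ0 (fun d => ?_) h1
    simp only [κ]
    split_ifs with h
    · positivity
    · exact (hP d h).2.2.2
  have hloglim : Tendsto (fun k => Nat.log 2 k) atTop atTop := by
    refine tendsto_atTop.2 fun M => ?_
    filter_upwards [eventually_ge_atTop (2 ^ M)] with k hk
    exact Nat.le_log_of_pow_le one_lt_two hk
  -- The potential is the feedback read along its own trajectory; any `w` with the same start and
  -- recursion coincides with that trajectory.
  refine ⟨fun k => Q k (W k), fun k => ?_, ?_, fun i w hw0 hw => ?_⟩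
  · rw [abs_of_nonneg (hQ k _).1]
    refine (hQ k _).2.trans ?_
    simp only [κ]
    split_ifs with h
    · exact hg k
    -- At `k = 0` the convention `Nat.log 2 0 = 0` puts `k` in block `0`, where `l N < 0` rules out
    -- a nonzero stage.
    · rcases Nat.eq_zero_or_pos k with rfl | hk
      · have := (hP _ h).1
        simp at this
      have h1 := (hP _ h).2.1 k (Nat.pow_log_le_self 2 hk.ne')
      have h2 : (k : ℝ) ≤ 2 * 2 ^ Nat.log 2 k := by
        have := (Nat.lt_pow_succ_log_self one_lt_two k).le
        rw [pow_succ, mul_comm] at this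
        exact_mod_cast this
      rw [div_le_iff₀ (by positivity)]
      nlinarith [hg k]
  · exact squeeze_zero (fun k => (hQ k _).1) (fun k => (hQ k _).2) (hκlim.comp hloglim)
  · have hwW : ∀ k, w k = W k i := by
      intro k
      induction k with
      | zero => exact hw0
      | succ k ih => rw [hw, ih]; rfl
    simp only [hwW]
    obtain ⟨D, hD⟩ := eventually_atTop.1
      ((hstage.eventually_ne_atTop 0).and (hstage.eventually (hS i)))
    have key : ∀ d ≥ D, (∀ k, 2 ^ d ≤ k → k < 2 ^ (d + 1) → ‖W (k + 1) i‖ ^ 2 ≤ ‖W k i‖ ^ 2) ∧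
        ‖W (2 ^ (d + 1)) i‖ ^ 2 ≤ ‖W (2 ^ d) i‖ ^ 2 / 4 := by
      intro d hd
      obtain ⟨hne, hi⟩ := hD d hd
      obtain ⟨hld, -, hακ, -⟩ := hP d hne
      have hκd : κ d = H (stage d) / 2 ^ d := if_neg hne
      obtain ⟨hm, hc⟩ := kickedState_contract (w₀ := w₀) (Q := Q) he (S := S (stage d))
        (κ := κ d) (a := 2 ^ d) (b := 2 ^ (d + 1)) (L := 2 ^ l (stage d)) (hκ0 d)
        (by rw [hκd]; exact hακ) (fun k hk1 hk2 w => by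
          simp only [Q, hlog d k hk1 hk2]
          exact ⟨fun h => if_pos h, fun h => if_neg h⟩) (hl _)
      refine ⟨hm i hi, ?_⟩
      set x := |α i| * κ d / 4 with hx
      have hx0 : 0 ≤ x := by have := hκ0 d; positivity
      have hx1 : x ≤ 1 := by
        have := hακ i hi
        rw [← hκd] at this
        linarith
      have hiter : ∀ m, m * 2 ^ l (stage d) ≤ 2 ^ d →
          ‖W (2 ^ d + m * 2 ^ l (stage d)) i‖ ^ 2 ≤ (1 - x) ^ m * ‖W (2 ^ d) i‖ ^ 2 := by
        intro m
        induction m with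
        | zero => intro _; simp
        | succ m ih =>
          intro hm
          rw [Nat.succ_mul] at hm
          have h1 := hc i hi (2 ^ d + m * 2 ^ l (stage d)) (by omega) (by rw [pow_succ]; omega)
          rw [Nat.succ_mul, ← add_assoc]
          refine h1.trans ?_
          rw [pow_succ (1 - x), mul_comm _ (1 - x), mul_assoc]
          exact mul_le_mul_of_nonneg_left (ih ((Nat.le_add_right _ _).trans hm)) (by linarith)
      have hpq : 2 ^ (d - l (stage d)) * 2 ^ l (stage d) = 2 ^ d := by
        rw [← pow_add]; congr 1; omega
      have h1 := hiter (2 ^ (d - l (stage d))) hpq.le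
      rw [hpq, ← two_mul, ← pow_succ'] at h1
      refine h1.trans ?_
      have h2 := one_sub_pow_le_quarter (m := 2 ^ (d - l (stage d))) hx0 hx1 (by
        have h3 := hH1 _ i hi
        have h4 : ((2 ^ (d - l (stage d)) : ℕ) : ℝ) * 2 ^ l (stage d) = 2 ^ d := by
          exact_mod_cast hpq
        have h5 : (0 : ℝ) < 2 ^ l (stage d) := by positivity
        rw [hx, hκd, ← h4]
        have h6 : (0 : ℝ) < ((2 ^ (d - l (stage d)) : ℕ) : ℝ) := by positivity
        have h7 : ((2 ^ (d - l (stage d)) : ℕ) : ℝ) * (|α i| *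
            (H (stage d) / (((2 ^ (d - l (stage d)) : ℕ) : ℝ) * 2 ^ l (stage d))) / 4) =
            |α i| * H (stage d) / (4 * 2 ^ l (stage d)) := by
          field_simp
        rw [h7, le_div_iff₀ (by positivity)]
        linarith)
      have := mul_le_mul_of_nonneg_right h2 (sq_nonneg ‖W (2 ^ d) i‖)
      linarith
    refine summable_of_dyadic_quarter (D := D) (fun k => sq_nonneg _) (fun d hd k hk1 hk2 => ?_)
      fun d hd => (key d hd).2
    obtain ⟨s, rfl⟩ := Nat.exists_eq_add_of_le hk1
    clear hk1
    induction s with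
    | zero => exact le_rfl
    | succ s ih =>
      exact ((key d hd).1 (2 ^ d + s) (by omega) (by omega)).trans (ih (by omega))

/-! ### Reduction of the Jacobi recurrence to kicked rotations -/

/-- A real `2 × 2` matrix of determinant one with `|tr| < 2` has a left eigenvector `(1, c)` with
nonreal `c`. -/
theorem exists_left_eigenvector {A : Matrix (Fin 2) (Fin 2) ℝ} (hdet : A.det = 1)
    (htr : |A.trace| < 2) : ∃ c : ℂ, c.im ≠ 0 ∧
      A 0 0 + c * A 1 0 = Complex.exp (Real.arccos (A.trace / 2) * Complex.I) ∧
      A 0 1 + c * A 1 1 = Complex.exp (Real.arccos (A.trace / 2) * Complex.I) * c := by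
  rw [Matrix.det_fin_two] at hdet
  rw [Matrix.trace_fin_two, abs_lt] at htr
  rw [Matrix.trace_fin_two]
  set θ := Real.arccos ((A 0 0 + A 1 1) / 2) with hθ
  have hcos : Real.cos θ = (A 0 0 + A 1 1) / 2 := Real.cos_arccos (by linarith) (by linarith)
  have hsin : Real.sin θ ≠ 0 := by
    intro h
    have := Real.sin_sq_add_cos_sq θ
    rw [h, hcos] at this
    nlinarith
  -- Otherwise `A 0 0 * A 1 1 = 1`, and the squared trace is `(A 0 0 - A 1 1)² + 4 ≥ 4`.
  have h10 : A 1 0 ≠ 0 := by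
    intro h
    rw [h] at hdet
    nlinarith [sq_nonneg (A 0 0 - A 1 1)]
  have h10' : (A 1 0 : ℂ) ≠ 0 := by exact_mod_cast h10
  set e := Complex.exp (θ * Complex.I) with he
  have hre : e.re = Real.cos θ := Complex.exp_ofReal_mul_I_re θ
  have him : e.im = Real.sin θ := Complex.exp_ofReal_mul_I_im θ
  have hquad : e ^ 2 - (A 0 0 + A 1 1) * e + 1 = 0 := by
    have h := Real.sin_sq_add_cos_sq θ
    have h2 : A 0 0 + A 1 1 = 2 * Real.cos θ := by rw [hcos]; ring
    have h2' : (A 0 0 : ℂ) + A 1 1 = ((2 * Real.cos θ : ℝ) : ℂ) := by rw [← h2]; push_cast; rfl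
    rw [h2']
    apply Complex.ext
    · simp only [sq, Complex.add_re, Complex.sub_re, Complex.mul_re, hre, him, Complex.ofReal_re,
        Complex.ofReal_im, Complex.one_re, Complex.zero_re]
      linarith
    · simp only [sq, Complex.add_im, Complex.sub_im, Complex.mul_im, hre, him, Complex.ofReal_re,
        Complex.ofReal_im, Complex.one_im, Complex.zero_im]
      ring
  have hdet' : (A 0 0 : ℂ) * A 1 1 - A 0 1 * A 1 0 = 1 := by exact_mod_cast hdet
  refine ⟨(e - A 0 0) / A 1 0, ?_, ?_, ?_⟩
  · rw [Complex.div_ofReal_im, Complex.sub_im, Complex.ofReal_im, sub_zero, him]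
    exact div_ne_zero hsin h10
  · field_simp
    ring
  · field_simp
    linear_combination -hquad - hdet'

/-- The solution of the three-term recurrence with `u₀ = 0`, `u₁ = 1`. -/
noncomputable def PeriodicJacobi.solution {T : ℕ} (J : PeriodicJacobi T) (q : ℕ → ℝ) (lam : ℝ) :
    ℕ → ℝ
  | 0 => 0
  | 1 => 1
  | m + 2 => (lam - J.b (m + 1) - q (m + 1)) / J.a (m + 1) * J.solution q lam (m + 1) -
      J.a m / J.a (m + 1) * J.solution q lam m

namespace PeriodicJacobi

variable {T : ℕ} (J : PeriodicJacobi T)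

theorem solution_add_two (q : ℕ → ℝ) (lam : ℝ) (m : ℕ) : J.solution q lam (m + 2) =
    (lam - J.b (m + 1) - q (m + 1)) / J.a (m + 1) * J.solution q lam (m + 1) -
      J.a m / J.a (m + 1) * J.solution q lam m := by
  rw [solution]

theorem a_add_mul (k m : ℕ) : J.a (k * T + m) = J.a m := by
  have h : Function.Periodic J.a T := J.a_periodic
  have := h.nat_mul k m
  rw [add_comm]
  simpa using this

theorem b_add_mul (k m : ℕ) : J.b (k * T + m) = J.b m := by
  have h : Function.Periodic J.b T := J.b_periodic
  have := h.nat_mul k m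
  rw [add_comm]
  simpa using this

/-- Inside a period, the potential acts as a shear followed by the unperturbed transfer. -/
theorem solution_eq_mulVec {q : ℕ → ℝ} (lam : ℝ) {k : ℕ}
    (hq : ∀ j, 0 < j → j < T → q (k * T + j + 1) = 0) (j : ℕ) (hj : j < T) :
    ![J.solution q lam (k * T + (j + 1)), J.solution q lam (k * T + (j + 1) + 1)] =
      (J.transferProd lam (j + 1)).mulVec
        ![J.solution q lam (k * T) + q (k * T + 1) / J.a 0 * J.solution q lam (k * T + 1),
          J.solution q lam (k * T + 1)] := by
  have h0 := (J.a_pos 0).ne'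
  induction j with
  | zero =>
    have h1 := (J.a_pos 1).ne'
    -- The term `-(q / a₁) u_{kT+1}` equals `-(a₀ / a₁)` times `(q / a₀) u_{kT+1}`, so it can be
    -- absorbed into the first coordinate.
    have e := J.solution_add_two q lam (k * T)
    rw [J.a_add_mul, J.b_add_mul, show J.a (k * T) = J.a 0 from J.a_add_mul k 0] at e
    ext i
    fin_cases i
    · simp [transferProd, transfer, Matrix.mulVec, dotProduct, Fin.sum_univ_two]
    · simp [transferProd, transfer, Matrix.mulVec, dotProduct, Fin.sum_univ_two, e]
      field_simp
      ring
  | succ j ih =>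
    have h1 := (J.a_pos (j + 2)).ne'
    have e := J.solution_add_two q lam (k * T + (j + 1))
    rw [show k * T + (j + 1) + 1 = k * T + (j + 2) by ring, J.a_add_mul, J.b_add_mul, J.a_add_mul,
      show k * T + (j + 2) = k * T + (j + 1) + 1 by ring, hq (j + 1) (by omega) hj] at e
    rw [transferProd, ← Matrix.mulVec_mulVec, ← ih (by omega)]
    ext i
    fin_cases i
    · simp [transfer, Matrix.mulVec, dotProduct, Fin.sum_univ_two, add_assoc]
    · simp [transfer, Matrix.mulVec, dotProduct, Fin.sum_univ_two]
      rw [show k * T + (j + 1 + 1) + 1 = k * T + (j + 1) + 2 by ring, e,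
        show j + 1 + 1 = j + 2 by ring]
      ring

/-- In the eigenvector coordinate of the monodromy matrix, one period acts as a kick followed by a
rotation. -/
theorem solution_period {q : ℕ → ℝ} {lam : ℝ} {k : ℕ}
    (hq : ∀ j, 0 < j → j < T → q (k * T + j + 1) = 0) {c e : ℂ}
    (h0 : (J.monodromy lam 0 0 : ℂ) + c * J.monodromy lam 1 0 = e)
    (h1 : (J.monodromy lam 0 1 : ℂ) + c * J.monodromy lam 1 1 = e * c) :
    (J.solution q lam ((k + 1) * T) : ℂ) + c * J.solution q lam ((k + 1) * T + 1) =
      e * (J.solution q lam (k * T) + c * J.solution q lam (k * T + 1) +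
        ((q (k * T + 1) / J.a 0 * J.solution q lam (k * T + 1) : ℝ) : ℂ)) := by
  have hT := J.period_pos
  have h := J.solution_eq_mulVec lam hq (T - 1) (by omega)
  rw [show T - 1 + 1 = T by omega, ← monodromy] at h
  have e0 := congrFun h 0
  have e1 := congrFun h 1
  simp only [Matrix.mulVec, dotProduct, Fin.sum_univ_two, Matrix.cons_val_zero,
    Matrix.cons_val_one] at e0 e1
  rw [show (k + 1) * T = k * T + T by ring, e0, e1]
  push_cast
  linear_combination ((J.solution q lam (k * T) : ℂ) +
    q (k * T + 1) / J.a 0 * J.solution q lam (k * T + 1)) * h0 +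
    (J.solution q lam (k * T + 1) : ℂ) * h1

/-! ### From square summability to eigenvectors -/

/-- A square summable solution of the recurrence is an eigenvector of the Jacobi matrix. -/
theorem hasL2Eigenvector_of_summable {q : ℕ → ℝ} {lam : ℝ}
    (h : Summable fun m => J.solution q lam m ^ 2) :
    HasL2Eigenvector (J.matrix + Matrix.diagonal fun m : ℕ+ => q m) lam := by
  have hmem : Memℓp (fun m : ℕ+ => J.solution q lam m) 2 := by
    refine memℓp_gen ?_
    have := h.comp_injective PNat.coe_injective
    simpa [Function.comp_def] using this
  refine ⟨⟨_, hmem⟩, fun h0 => ?_, fun i => ?_⟩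
  · have h1 : J.solution q lam ((1 : ℕ+) : ℕ) = 0 :=
      congrFun (congrArg (fun f : lp (fun _ : ℕ+ => ℝ) 2 => (f : ℕ+ → ℝ)) h0) 1
    rw [PNat.one_coe, solution] at h1
    exact one_ne_zero h1
  · change HasSum (fun j : ℕ+ => (J.matrix + Matrix.diagonal fun m : ℕ+ => q m) i j *
      J.solution q lam j) (lam * J.solution q lam i)
    have hsplit : (fun j : ℕ+ => (J.matrix + Matrix.diagonal fun m : ℕ+ => q m) i j *
        J.solution q lam j) = fun j => ((if j = i then (J.b i + q i) * J.solution q lam i else 0) +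
          (if j = i + 1 then J.a i * J.solution q lam ((i : ℕ) + 1) else 0)) +
          (if i = j + 1 then J.a j * J.solution q lam j else 0) := by
      funext j
      have hlt : ∀ m : ℕ+, m < m + 1 := fun m => PNat.lt_add_one_iff.2 le_rfl
      simp only [Matrix.add_apply, matrix, Matrix.diagonal_apply]
      by_cases h1 : j = i
      · subst h1
        simp [(hlt j).ne]
      · by_cases h2 : j = i + 1
        · subst h2
          have h3 : i ≠ i + 1 + 1 := ((hlt i).trans (hlt _)).ne
          simp [(hlt i).ne', (hlt i).ne, h3]
        · have h3 : ¬ i = j := fun h => h1 h.symm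
          simp [h1, h2, h3]
    rw [hsplit]
    have s1 := (hasSum_ite_eq i ((J.b i + q i) * J.solution q lam i)).add
      (hasSum_ite_eq (i + 1) (J.a i * J.solution q lam ((i : ℕ) + 1)))
    obtain ⟨m, hm⟩ : ∃ m : ℕ, (i : ℕ) = m + 1 := ⟨i - 1, by have := i.pos; omega⟩
    have e := J.solution_add_two q lam m
    have ha := (J.a_pos (m + 1)).ne'
    have s2 : HasSum (fun j : ℕ+ => if i = j + 1 then J.a j * J.solution q lam j else 0)
        (J.a m * J.solution q lam m) := by
      -- The first row has no lower neighbour; `u₀ = 0` makes the extra recurrence term vanish.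
      rcases Nat.eq_zero_or_pos m with rfl | hmp
      · have h1 : ∀ j : ℕ+, i ≠ j + 1 := fun j hj => by
          have := congrArg PNat.val hj
          have h2 := j.pos
          rw [PNat.add_coe, PNat.one_coe] at this
          omega
        simp [h1, solution, hasSum_zero]
      · obtain ⟨p, rfl⟩ : ∃ p : ℕ+, (p : ℕ) = m := ⟨⟨m, hmp⟩, rfl⟩
        obtain rfl : i = p + 1 := PNat.coe_inj.1 (by rw [hm, PNat.add_coe, PNat.one_coe])
        have h2 : (fun j : ℕ+ => if p + 1 = j + 1 then J.a j * J.solution q lam j else 0) =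
            fun j => if j = p then J.a p * J.solution q lam p else 0 := by
          funext j
          by_cases hj : j = p
          · subst hj
            simp
          · rw [if_neg hj, if_neg fun h => hj (add_right_cancel h).symm]
        rw [h2]
        exact hasSum_ite_eq _ _
    convert s1.add s2 using 1
    rw [hm, add_assoc, e]
    field_simp
    ring

end PeriodicJacobi

theorem Function.Periodic.exists_abs_le {f : ℕ → ℝ} {T : ℕ} (hT : 0 < T)
    (hf : Function.Periodic f T) : ∃ C, ∀ n, |f n| ≤ C := by
  refine ⟨∑ j ∈ Finset.range T, |f j|, fun n => ?_⟩
  rw [← hf.map_mod_nat]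
  exact Finset.single_le_sum (f := fun j => |f j|) (fun j _ => abs_nonneg _)
    (Finset.mem_range.2 (Nat.mod_lt n hT))

/-- Square summability of a solution of a three-term recurrence with bounded coefficients can be
tested at one pair of neighbouring sites in every period. -/
theorem summable_sq_of_period {u x y : ℕ → ℝ} {T : ℕ} (hT : 0 < T) {X Y : ℝ}
    (hx : ∀ m, |x m| ≤ X) (hy : ∀ m, |y m| ≤ Y)
    (hu : ∀ m, u (m + 2) = x m * u (m + 1) - y m * u m)
    (h : Summable fun k => u (k * T) ^ 2 + u (k * T + 1) ^ 2) : Summable fun m => u m ^ 2 := by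
  set C := 2 * X ^ 2 + 2 * Y ^ 2 + 1 with hC
  have hC1 : 1 ≤ C := by rw [hC]; nlinarith [sq_nonneg X, sq_nonneg Y]
  have hstep : ∀ m, u (m + 1) ^ 2 + u (m + 2) ^ 2 ≤ C * (u m ^ 2 + u (m + 1) ^ 2) := by
    intro m
    have h1 : x m ^ 2 ≤ X ^ 2 := sq_le_sq' (abs_le.1 (hx m)).1 (abs_le.1 (hx m)).2
    have h2 : y m ^ 2 ≤ Y ^ 2 := sq_le_sq' (abs_le.1 (hy m)).1 (abs_le.1 (hy m)).2
    have h3 : u (m + 2) ^ 2 ≤ 2 * (x m ^ 2 * u (m + 1) ^ 2) + 2 * (y m ^ 2 * u m ^ 2) := by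
      rw [hu]; nlinarith [sq_nonneg (x m * u (m + 1) + y m * u m)]
    have h4 := mul_le_mul_of_nonneg_right h1 (sq_nonneg (u (m + 1)))
    have h5 := mul_le_mul_of_nonneg_right h2 (sq_nonneg (u m))
    have h6 := mul_nonneg (sq_nonneg X) (sq_nonneg (u m))
    have h7 := mul_nonneg (sq_nonneg Y) (sq_nonneg (u (m + 1)))
    rw [hC]
    nlinarith [sq_nonneg (u m)]
  have hiter : ∀ k j, u (k * T + j) ^ 2 + u (k * T + j + 1) ^ 2 ≤
      C ^ j * (u (k * T) ^ 2 + u (k * T + 1) ^ 2) := by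
    intro k j
    induction j with
    | zero => simp
    | succ j ih =>
      refine (hstep (k * T + j)).trans ?_
      rw [pow_succ C, mul_comm _ C, mul_assoc]
      exact mul_le_mul_of_nonneg_left ih (by linarith)
  have : NeZero T := ⟨hT.ne'⟩
  have hprod : Summable fun z : ℕ × Fin T =>
      (C ^ T * (u (z.1 * T) ^ 2 + u (z.1 * T + 1) ^ 2)) * 1 :=
    (h.mul_left (C ^ T)).mul_of_nonneg (g := fun _ : Fin T => (1 : ℝ)) Summable.of_finite
      (fun k => by positivity) (fun _ => zero_le_one)
  rw [← (Nat.divModEquiv T).symm.summable_iff]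
  refine Summable.of_nonneg_of_le (fun z => sq_nonneg _) (fun z => ?_) hprod
  obtain ⟨k, j⟩ := z
  have h1 := hiter k j
  have h2 : C ^ (j : ℕ) ≤ C ^ T := pow_le_pow_right₀ hC1 j.2.le
  have h3 : 0 ≤ u (k * T) ^ 2 + u (k * T + 1) ^ 2 := by positivity
  have h4 := mul_le_mul_of_nonneg_right h2 h3
  have h5 : (Nat.divModEquiv T).symm (k, j) = k * T + j := rfl
  simp only [Function.comp_apply, h5, mul_one]
  nlinarith [sq_nonneg (u (k * T + j + 1))]

/-- The solution at an elliptic energy is square summable as soon as its eigenvector coordinate,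
taken once per period, is. -/
theorem PeriodicJacobi.hasL2Eigenvector_of_summable_coord {T : ℕ} (J : PeriodicJacobi T)
    {q : ℕ → ℝ} {B : ℝ} (hqB : ∀ m, |q m| ≤ B) {lam : ℝ} {c : ℂ} (hc : c.im ≠ 0)
    (h : Summable fun k => ‖(J.solution q lam (k * T) : ℂ) +
      c * J.solution q lam (k * T + 1)‖ ^ 2) :
    HasL2Eigenvector (J.matrix + Matrix.diagonal fun m : ℕ+ => q m) lam := by
  obtain ⟨A, hA⟩ := Function.Periodic.exists_abs_le J.period_pos (f := J.a) J.a_periodic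
  obtain ⟨A', hA'⟩ := Function.Periodic.exists_abs_le J.period_pos (f := fun n => (J.a n)⁻¹)
    (fun n => by simp only [J.a_periodic])
  obtain ⟨b, hb⟩ := Function.Periodic.exists_abs_le J.period_pos (f := J.b) J.b_periodic
  refine J.hasL2Eigenvector_of_summable (summable_sq_of_period J.period_pos
    (X := (|lam| + b + B) * A') (Y := A * A') (fun m => ?_) (fun m => ?_)
    (J.solution_add_two q lam) ?_)
  · rw [div_eq_mul_inv, abs_mul]
    have h1 := abs_sub (lam - J.b (m + 1)) (q (m + 1))
    have h2 := abs_sub lam (J.b (m + 1))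
    have h3 := hb (m + 1)
    have h4 := hqB (m + 1)
    exact mul_le_mul (by linarith) (hA' _) (abs_nonneg _)
      ((abs_nonneg _).trans (h1.trans (by linarith)))
  · rw [div_eq_mul_inv, abs_mul]
    exact mul_le_mul (hA _) (hA' _) (abs_nonneg _) ((abs_nonneg _).trans (hA 0))
  -- For nonreal `c`, `|s + c t|² = (s + Re c * t)² + (Im c)² t²` is positive definite, so it
  -- controls both coordinates.
  · have hbound : ∀ s t : ℝ, s ^ 2 + t ^ 2 ≤
        (2 + (2 * c.re ^ 2 + 1) / c.im ^ 2) * ‖(s : ℂ) + c * t‖ ^ 2 := by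
      intro s t
      have hcim : 0 < c.im ^ 2 := by positivity
      have h1 : ‖(s : ℂ) + c * t‖ ^ 2 = (s + c.re * t) ^ 2 + c.im ^ 2 * t ^ 2 := by
        rw [Complex.sq_norm, Complex.normSq_apply]
        simp
        ring
      have h2 : t ^ 2 ≤ ‖(s : ℂ) + c * t‖ ^ 2 / c.im ^ 2 := by
        rw [le_div_iff₀ hcim, h1]
        nlinarith [sq_nonneg (s + c.re * t)]
      have h3 : s ^ 2 ≤ 2 * ‖(s : ℂ) + c * t‖ ^ 2 + 2 * c.re ^ 2 * t ^ 2 := by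
        rw [h1]
        nlinarith [sq_nonneg (s + 2 * c.re * t), mul_nonneg hcim.le (sq_nonneg t)]
      calc s ^ 2 + t ^ 2 ≤ 2 * ‖(s : ℂ) + c * t‖ ^ 2 + (2 * c.re ^ 2 + 1) * t ^ 2 := by linarith
        _ ≤ 2 * ‖(s : ℂ) + c * t‖ ^ 2 +
            (2 * c.re ^ 2 + 1) * (‖(s : ℂ) + c * t‖ ^ 2 / c.im ^ 2) := by gcongr
        _ = _ := by ring
    exact Summable.of_nonneg_of_le (fun k => by positivity) (fun k => hbound _ _) (h.mul_left _)

/-! ### Assembly -/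

theorem theorem5p1 {T : ℕ} (J : PeriodicJacobi T)
    -- the finitely many exceptional eigenvalues
    (n : ℕ) (mu : Fin n → ℝ) (num den : Fin n → ℕ)
    (hmu : ∀ i, mu i ∈ J.ellipticSet)
    (hmu_theta : ∀ i, J.quasimomentum (mu i) = num i * Real.pi / den i)
    (hlowest : ∀ i, Nat.Coprime (num i) (den i))
    (hcoprime : ∀ i j, i ≠ j → Nat.Coprime (den i) (den j))
    (hmu_half : ∀ i, J.quasimomentum (mu i) ≠ Real.pi / 2)
    -- the infinite sequence of eigenvalues
    (lam : ℕ → ℝ)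
    (hlam : ∀ i, lam i ∈ J.ellipticSet)
    (hindep : ∀ k : ℕ, LinearIndependent ℚ
      (Fin.cons Real.pi (fun j : Fin k => J.quasimomentum (lam j)) : Fin (k + 1) → ℝ))
    -- the bound on the potential
    (K : ℕ+ → ℝ) (hK_pos : ∀ m, 0 < K m) (hK : Tendsto K atTop atTop) :
    ∃ q : ℕ+ → ℝ,
      (∀ m : ℕ+, |q m| ≤ K m / m) ∧
      Tendsto q atTop (𝓝 0) ∧
      (∀ m : ℕ+, ¬ (m : ℕ) ≡ 1 [MOD T] → q m = 0) ∧
      (∀ i, HasL2Eigenvector (J.matrix + Matrix.diagonal q) (mu i)) ∧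
      (∀ i, HasL2Eigenvector (J.matrix + Matrix.diagonal q) (lam i)) := by
  have hT := J.period_pos
  let ev : Fin n ⊕ ℕ → ℝ := Sum.elim mu lam
  have hev : ∀ i, ev i ∈ J.ellipticSet := by
    rintro (i | i)
    · exact hmu i
    · exact hlam i
  choose c hc hc0 hc1 using fun i => exists_left_eigenvector (J.det_monodromy (ev i)) (hev i)
  let e : Fin n ⊕ ℕ → ℂ := fun i => Complex.exp (J.quasimomentum (ev i) * Complex.I)
  have he2 : ∀ i, e i ^ 2 =
      Complex.exp (2 * Real.pi * Complex.I * ((J.quasimomentum (ev i) / Real.pi : ℝ) : ℂ)) := by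
    intro i
    have : (Real.pi : ℂ) ≠ 0 := by simp [Real.pi_ne_zero]
    rw [← Complex.exp_nat_mul]
    congr 1
    push_cast
    field_simp
  have ha0 := J.a_pos 0
  have hret : ∀ N, ∃ L : ℕ, ∀ z : Fin n ⊕ ℕ → ℂ, ∃ t < L,
      ∀ i ∈ (Finset.univ : Finset (Fin n)).disjSum (Finset.range N),
        ‖z i‖ / 2 ≤ (z i * (e i ^ 2) ^ t).im := by
    intro N
    have hden : ∀ i, 0 < den i := by
      intro i
      rw [Nat.pos_iff_ne_zero]
      intro h
      have h1 := (J.quasimomentum_spec (hmu i)).1.1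
      rw [hmu_theta, h] at h1
      simp at h1
    obtain ⟨L, hL⟩ := exists_uniform_return_mixed (fun i => e (.inl i) ^ 2) den hden
      (fun i => by
        have h1 : (Real.pi : ℂ) ≠ 0 := by simp [Real.pi_ne_zero]
        have h2 : (den i : ℂ) ≠ 0 := by exact_mod_cast (hden i).ne'
        rw [he2, ← Complex.exp_nat_mul, Complex.exp_eq_one_iff]
        refine ⟨num i, ?_⟩
        change (den i : ℂ) * (2 * Real.pi * Complex.I *
          ((J.quasimomentum (mu i) / Real.pi : ℝ) : ℂ)) = _
        rw [hmu_theta]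
        push_cast
        field_simp)
      -- If `exp(4iθ) = 1` then `2θ/π` is an integer strictly between `0` and `2`, so `θ = π/2`.
      (fun i h => by
        have h1 := (J.quasimomentum_spec (hmu i)).1
        rw [he2, ← Complex.exp_nat_mul, Complex.exp_eq_one_iff] at h
        obtain ⟨m, hm⟩ := h
        rw [show ev (.inl i) = mu i from rfl] at hm
        have h2 : (2 * Real.pi * Complex.I : ℂ) ≠ 0 := by simp [Real.pi_ne_zero]
        have h3 : ((2 * (J.quasimomentum (mu i) / Real.pi) : ℝ) : ℂ) = m := by
          refine mul_right_cancel₀ h2 ?_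
          rw [← hm]
          push_cast
          ring
        have h4 : 2 * (J.quasimomentum (mu i) / Real.pi) = m := by exact_mod_cast h3
        have h5 : 2 * J.quasimomentum (mu i) = m * Real.pi := by
          rw [← h4]; field_simp
        have h6 : (0 : ℝ) < m := by
          by_contra! h
          nlinarith [h1.1, Real.pi_pos]
        have h7 : (m : ℝ) < 2 := by
          by_contra! h
          nlinarith [h1.2, Real.pi_pos]
        have h8 : m = 1 := by
          have h9 : 0 < m := by exact_mod_cast h6
          have h10 : m < 2 := by exact_mod_cast h7
          omega
        rw [h8] at h5
        push_cast at h5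
        exact hmu_half i (by linarith))
      hcoprime (fun j : Fin N => J.quasimomentum (lam j) / Real.pi)
      (fun m hm l hl => by
        refine hm ?_
        have h1 := Fintype.linearIndependent_iff.1 (hindep N)
          (Fin.cons (-(l : ℚ)) fun j => (m j : ℚ)) (by
            rw [Fin.sum_univ_succ]
            simp only [Fin.cons_zero, Fin.cons_succ, Rat.smul_def]
            push_cast
            rw [← hl, neg_mul, Finset.sum_mul, neg_add_eq_zero]
            refine Finset.sum_congr rfl fun j _ => ?_
            have := Real.pi_ne_zero
            field_simp)
        ext j
        have := h1 j.succ
        simpa using this)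
    refine ⟨L, fun z => ?_⟩
    obtain ⟨t, ht, h1, h2⟩ := hL (fun i => z (.inl i)) (fun j => z (.inr j))
    refine ⟨t, ht, ?_⟩
    rintro (i | j) hi
    · exact h1 i
    · rw [he2]
      exact h2 ⟨j, by simpa using hi⟩
  -- The allowance `K m / m` at `m = kT + 1`, the only site of the period that is perturbed.
  let g : ℕ → ℝ := fun k => K (k * T).succPNat / ((k * T).succPNat : ℕ)
  have hg' : Tendsto (fun k : ℕ => k * g k) atTop atTop := by
    have h1 : Tendsto (fun k : ℕ => (k * T).succPNat) atTop atTop := by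
      refine tendsto_atTop.2 fun M => ?_
      filter_upwards [eventually_ge_atTop (M : ℕ)] with k hk
      rw [← PNat.coe_le_coe, Nat.succPNat_coe]
      have := Nat.le_mul_of_pos_right k hT
      omega
    refine tendsto_atTop_mono' _ ?_
      ((hK.comp h1).const_mul_atTop (r := 1 / (2 * (T : ℝ))) (by positivity))
    filter_upwards [eventually_ge_atTop 1] with k hk
    have hk' : (1 : ℝ) ≤ k := by exact_mod_cast hk
    have hT' : (1 : ℝ) ≤ T := by exact_mod_cast hT
    have h2 : ((((k * T).succPNat : ℕ+) : ℕ) : ℝ) = k * T + 1 := by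
      rw [Nat.succPNat_coe]; push_cast; ring
    have h3 := hK_pos (k * T).succPNat
    simp only [g, Function.comp_apply, h2]
    rw [one_div_mul_eq_div, mul_div_assoc', div_le_div_iff₀ (by positivity) (by positivity)]
    nlinarith [mul_le_mul_of_nonneg_left (show (k : ℝ) * T + 1 ≤ k * (2 * T) by nlinarith) h3.le]
  -- As `Im w = Im c * u_{kT+1}`, this `α` turns the shear `(q / a₀) u_{kT+1}` into `α q Im w`; the
  -- initial state is `u₀ + c u₁ = c`.
  obtain ⟨p, hp1, hp2, hp3⟩ := exists_potential_summable e (fun i => 1 / (J.a 0 * (c i).im)) c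
    (fun i => Complex.norm_exp_ofReal_mul_I _)
    (fun i => one_div_ne_zero (mul_ne_zero ha0.ne' (hc i)))
    (fun N => (Finset.univ : Finset (Fin n)).disjSum (Finset.range N))
    (by
      rintro (i | j)
      · exact Eventually.of_forall fun N => by simp
      · filter_upwards [eventually_gt_atTop j] with N hN
        simpa using hN)
    hret g (fun k => (div_pos (hK_pos _) (by positivity)).le) hg'
  -- Truncated subtraction gives `q 0` a value, but neither the matrix nor the recurrence uses it.
  let q : ℕ → ℝ := fun m => if (m - 1) % T = 0 then p ((m - 1) / T) else 0
  have hqk : ∀ k, q (k * T + 1) = p k := fun k => by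
    simp [q, Nat.mul_div_cancel _ hT]
  have hq0 : ∀ k j, 0 < j → j < T → q (k * T + j + 1) = 0 := fun k j hj hjT => by
    have : (k * T + j) % T = j := by
      rw [add_comm, Nat.add_mul_mod_self_right, Nat.mod_eq_of_lt hjT]
    simp [q, this, hj.ne']
  have hqp : ∀ m, |q m| ≤ |p ((m - 1) / T)| := fun m => by
    simp only [q]
    split_ifs
    · exact le_rfl
    · simp
  obtain ⟨B, hB⟩ := hp2.abs.bddAbove_range
  have hqB : ∀ m, |q m| ≤ B := fun m => (hqp m).trans (hB ⟨_, rfl⟩)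
  have hfin : ∀ i, HasL2Eigenvector (J.matrix + Matrix.diagonal fun m : ℕ+ => q m) (ev i) := by
    intro i
    refine J.hasL2Eigenvector_of_summable_coord hqB (hc i) (hp3 i _ ?_ fun k => ?_)
    · simp [PeriodicJacobi.solution]
    · rw [J.solution_period (hq0 k) (hc0 i) (hc1 i), hqk]
      change e i * _ = _
      congr 3
      have := hc i
      simp
      field_simp
  refine ⟨fun m => q m, fun m => ?_, ?_, fun m hm => ?_, fun i => hfin (.inl i),
    fun i => hfin (.inr i)⟩
  · simp only [q]
    split_ifs with h
    · refine (hp1 _).trans_eq ?_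
      have h1 : ((((m : ℕ) - 1) / T) * T).succPNat = m := by
        rw [← PNat.coe_inj, Nat.succPNat_coe, Nat.div_mul_cancel (Nat.dvd_of_mod_eq_zero h)]
        have := m.pos
        omega
      simp only [g, h1]
    · rw [abs_zero]
      exact (div_pos (hK_pos m) (by positivity)).le
  · have h1 : Tendsto (fun m : ℕ+ => ((m : ℕ) - 1) / T) atTop atTop := by
      refine tendsto_atTop.2 fun M => ?_
      filter_upwards [eventually_ge_atTop (M * T).succPNat] with m hm
      rw [← PNat.coe_le_coe, Nat.succPNat_coe] at hm
      rw [Nat.le_div_iff_mul_le hT]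
      omega
    refine squeeze_zero_norm (fun m => hqp m) ?_
    have := (hp2.comp h1).abs
    simpa using this
  · refine if_neg fun h => hm ?_
    have h1 := m.pos
    rw [Nat.ModEq.comm, Nat.modEq_iff_dvd' h1]
    exact Nat.dvd_of_mod_eq_zero h
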